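/- Let $d,n$ be positive integers. A possibly non-proper $n$-partition of $\mathbb{R}^d$ is a list $(P_1,\dots,P_n)$ of pairwise disjoint, open, convex, possibly empty subsets of $\mathbb{R}^d$ with $\bigcup_{i=1}^n\overline{P_i}=\mathbb{R}^d$; it is proper if all $P_i$ are non-empty. A point $c=(c_{ij})_{1\le i<j\le n}\in(S^d)^{\binom n2}$, with unit vectors $c_{ij}\in S^d\subset\mathbb{R}^{d+1}$, represents a central oriented hyperplane arrangement in $\mathbb{R}^{d+1}$ with hyperplanes $\{y: c_{ij}\cdot y=0\}$; put $c_{ji}=-c_{ij}$ for $i<j$. The arrangement carries the $n$-partition $(P_1,\dots,P_n)$ if $$P_i=\Bigl\{x\in\mathbb{R}^d:\ c_{ij}\cdot\tbinom{1}{x}<0\ \text{ for all } j\in\{1,\dots,n\},\ j\neq i\Bigr\}\qquad(1\le i\le n).$$ Let $\mathcal{H}(\mathbb{R}^d,\le n)$ be the set of all $c\in(S^d)^{\binom n2}$ that carry a possibly non-proper $n$-partition of $\mathbb{R}^d$, and $\mathcal{H}(\mathbb{R}^d,n)$ the set of all $c\in(S^d)^{\binom n2}$ that carry a proper $n$-partition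 of $\mathbb{R}^d$. Then $\mathcal{H}(\mathbb{R}^d,\le n)$ and $\mathcal{H}(\mathbb{R}^d,n)$ are semialgebraic subsets of $(S^d)^{\binom n2}\subset\mathbb{R}^{(d+1)\times\binom n2}$, that is, each is a finite union of solution sets of systems of finitely many polynomial equations and strict polynomial inequalities in the coordinates of the $c_{ij}$. -/

import Mathlib

noncomputable section

namespace ConvexPartitions

/-- A subset of `ℝ^ι` is semialgebraic if it is a finite union of solution sets of systems of
finitely many polynomial equations and strict polynomial inequalities. A pair `q` in the finite
family is such a system: `q.1` holds the equations `f = 0`, `q.2` the inequalities `0 < g`. -/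
def IsSemialgebraic {ι : Type*} (X : Set (ι → ℝ)) : Prop :=
  ∃ F : Finset (Finset (MvPolynomial ι ℝ) × Finset (MvPolynomial ι ℝ)),
    X = {x | ∃ q ∈ F, (∀ f ∈ q.1, MvPolynomial.eval x f = 0) ∧
      (∀ g ∈ q.2, 0 < MvPolynomial.eval x g)}

/-- Lists of `n` pairwise disjoint open convex sets (possibly empty) whose closures cover `ℝ^d`. -/
structure IsPartition {d n : ℕ} (P : Fin n → Set (EuclideanSpace ℝ (Fin d))) : Prop where
  isOpen : ∀ i, IsOpen (P i)
  convex : ∀ i, Convex ℝ (P i)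
  disjoint : ∀ i j, i ≠ j → Disjoint (P i) (P j)
  cover : (⋃ i, closure (P i)) = Set.univ

/-- The set of all proper or non-proper `n`-partitions of `ℝ^d`. -/
def partitionsLE (d n : ℕ) : Set (Fin n → Set (EuclideanSpace ℝ (Fin d))) :=
  {P | IsPartition P}

/-- The set of all proper `n`-partitions of `ℝ^d`: all regions are non-empty. -/
def partitions (d n : ℕ) : Set (Fin n → Set (EuclideanSpace ℝ (Fin d))) :=
  {P | IsPartition P ∧ ∀ i, (P i).Nonempty}

/-- The index set of the `n choose 2` pairs `i < j`. -/
abbrev Pairs (n : ℕ) : Type := {p : Fin n × Fin n // p.1 < p.2}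

/-- The space `(S^d)^(n choose 2)`, whose points are the central oriented hyperplane arrangements
in `ℝ^(d+1)` with unit normal vectors `c_ij` for `i < j`. -/
abbrev Arrangement (d n : ℕ) : Type :=
  Pairs n → Metric.sphere (0 : EuclideanSpace ℝ (Fin (d + 1))) 1

/-- The inclusion of `(S^d)^(n choose 2)` into `ℝ^((d+1) × (n choose 2))`. -/
def coords {d n : ℕ} (c : Arrangement d n) : Pairs n × Fin (d + 1) → ℝ :=
  fun a => (c a.1 : EuclideanSpace ℝ (Fin (d + 1))) a.2

/-- The normal vectors `c_ij` for all `i ≠ j`, with `c_ji = -c_ij` (the value for `i = j` is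
never used). -/
def normal {d n : ℕ} (c : Arrangement d n) (i j : Fin n) : EuclideanSpace ℝ (Fin (d + 1)) :=
  if h : i < j then (c ⟨(i, j), h⟩ : EuclideanSpace ℝ (Fin (d + 1)))
  else if h : j < i then -(c ⟨(j, i), h⟩ : EuclideanSpace ℝ (Fin (d + 1)))
  else 0

/-- The vector `(1, x)` in `ℝ^(d+1)`. -/
def homogenize {d : ℕ} (x : EuclideanSpace ℝ (Fin d)) : EuclideanSpace ℝ (Fin (d + 1)) :=
  WithLp.toLp 2 (Fin.cons 1 (fun k => x k))

/-- The list of polyhedra `Q_i = {x : c_ij · (1, x) < 0 for all j ≠ i}` of an arrangement. -/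
def regionMap {d n : ℕ} (c : Arrangement d n) : Fin n → Set (EuclideanSpace ℝ (Fin d)) :=
  fun i => {x | ∀ j, j ≠ i → inner ℝ (normal c i j) (homogenize x) < 0}

/-- The arrangement `c` carries the partition `P`. -/
def Carries {d n : ℕ} (c : Arrangement d n)
    (P : Fin n → Set (EuclideanSpace ℝ (Fin d))) : Prop :=
  regionMap c = P

/-- The arrangements that carry a possibly non-proper `n`-partition of `ℝ^d`. -/
def arrangementsLE (d n : ℕ) : Set (Arrangement d n) :=
  {c | ∃ P ∈ partitionsLE d n, Carries c P}

/-- The arrangements that carry a proper `n`-partition of `ℝ^d`. -/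
def arrangements (d n : ℕ) : Set (Arrangement d n) :=
  {c | ∃ P ∈ partitions d n, Carries c P}

end ConvexPartitions

end

noncomputable section

namespace ConvexPartitions

open MvPolynomial

/-! ### Boolean operations on semialgebraic sets -/

section Semialgebraic

variable {ι : Type*}

/-! The regions of any arrangement are open, convex and pairwise disjoint, so only the covering
condition and non-emptiness constrain `c`. The closures fail to cover exactly when some `x` admits a
choice `f i ≠ i` with `c_{i,f(i)} · (1, x) > 0` for every `i`
(`iUnion_closure_regionMap_eq_univ_iff`). There are finitely many `f`, so covering is a finite
conjunction of unsolvability statements; properness adds finitely many solvability statements.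

Each such system is strict and affine in `x`, with coefficients polynomial in `c`. Hence full
quantifier elimination is not needed: Fourier–Motzkin (`isSemialgebraic_exists_forall_pos`) removes
`x`, and Boolean closure together with the sphere equations finishes the proof. -/

/-- The solution set of a single system of equations and strict inequalities. -/
theorem isSemialgebraic_system (A B : Finset (MvPolynomial ι ℝ)) :
    IsSemialgebraic {x : ι → ℝ | (∀ f ∈ A, eval x f = 0) ∧ ∀ g ∈ B, 0 < eval x g} :=
  ⟨{(A, B)}, by simp⟩

theorem isSemialgebraic_eq_zero (p : MvPolynomial ι ℝ) :
    IsSemialgebraic {x : ι → ℝ | eval x p = 0} := by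
  simpa using isSemialgebraic_system {p} ∅

theorem isSemialgebraic_pos (p : MvPolynomial ι ℝ) :
    IsSemialgebraic {x : ι → ℝ | 0 < eval x p} := by
  simpa using isSemialgebraic_system ∅ {p}

theorem isSemialgebraic_neg (p : MvPolynomial ι ℝ) :
    IsSemialgebraic {x : ι → ℝ | eval x p < 0} := by
  simpa using isSemialgebraic_pos (-p)

theorem isSemialgebraic_empty : IsSemialgebraic (∅ : Set (ι → ℝ)) :=
  ⟨∅, by simp⟩

theorem isSemialgebraic_univ : IsSemialgebraic (Set.univ : Set (ι → ℝ)) := by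
  simpa using isSemialgebraic_system (ι := ι) ∅ ∅

theorem IsSemialgebraic.union {X Y : Set (ι → ℝ)} (hX : IsSemialgebraic X)
    (hY : IsSemialgebraic Y) : IsSemialgebraic (X ∪ Y) := by
  classical
  obtain ⟨F, rfl⟩ := hX
  obtain ⟨G, rfl⟩ := hY
  refine ⟨F ∪ G, ?_⟩
  ext x
  simp only [Set.mem_union, Set.mem_ofPred_eq, Finset.mem_union, or_and_right, exists_or]

theorem IsSemialgebraic.inter {X Y : Set (ι → ℝ)} (hX : IsSemialgebraic X)
    (hY : IsSemialgebraic Y) : IsSemialgebraic (X ∩ Y) := by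
  classical
  obtain ⟨F, rfl⟩ := hX
  obtain ⟨G, rfl⟩ := hY
  refine ⟨(F ×ˢ G).image fun r => (r.1.1 ∪ r.2.1, r.1.2 ∪ r.2.2), ?_⟩
  ext x
  simp only [Set.mem_inter_iff, Set.mem_ofPred_eq, Finset.exists_mem_image, Finset.mem_product,
    Finset.forall_mem_union]
  constructor
  · rintro ⟨⟨q, hq, h1, h2⟩, r, hr, h3, h4⟩
    exact ⟨(q, r), ⟨hq, hr⟩, ⟨h1, h3⟩, h2, h4⟩
  · rintro ⟨⟨q, r⟩, ⟨hq, hr⟩, ⟨h1, h3⟩, h2, h4⟩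
    exact ⟨⟨q, hq, h1, h2⟩, r, hr, h3, h4⟩

theorem IsSemialgebraic.finset_iUnion {α : Type*} (s : Finset α) {X : α → Set (ι → ℝ)}
    (hX : ∀ a, IsSemialgebraic (X a)) : IsSemialgebraic (⋃ a ∈ s, X a) := by
  classical
  induction s using Finset.induction_on with
  | empty => simpa using isSemialgebraic_empty
  | insert a s _ ih => simpa [Finset.set_biUnion_insert] using (hX a).union ih

theorem IsSemialgebraic.finset_iInter {α : Type*} (s : Finset α) {X : α → Set (ι → ℝ)}
    (hX : ∀ a, IsSemialgebraic (X a)) : IsSemialgebraic (⋂ a ∈ s, X a) := by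
  classical
  induction s using Finset.induction_on with
  | empty => simpa using isSemialgebraic_univ
  | insert a s _ ih => simpa [Finset.set_biInter_insert] using (hX a).inter ih

theorem IsSemialgebraic.iUnion {α : Type*} [Finite α] {X : α → Set (ι → ℝ)}
    (hX : ∀ a, IsSemialgebraic (X a)) : IsSemialgebraic (⋃ a, X a) := by
  have := Fintype.ofFinite α
  simpa using IsSemialgebraic.finset_iUnion Finset.univ hX

theorem IsSemialgebraic.iInter {α : Type*} [Finite α] {X : α → Set (ι → ℝ)}
    (hX : ∀ a, IsSemialgebraic (X a)) : IsSemialgebraic (⋂ a, X a) := by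
  have := Fintype.ofFinite α
  simpa using IsSemialgebraic.finset_iInter Finset.univ hX

/-- De Morgan, with trichotomy of signs: `f ≠ 0` splits into two strict inequalities, and `¬ 0 < g`
into an equation and a strict inequality. -/
theorem IsSemialgebraic.compl {X : Set (ι → ℝ)} (hX : IsSemialgebraic X) :
    IsSemialgebraic Xᶜ := by
  obtain ⟨F, rfl⟩ := hX
  have key : IsSemialgebraic (⋂ q ∈ F,
      ((⋃ f ∈ q.1, ({x : ι → ℝ | 0 < eval x f} ∪ {x | eval x f < 0})) ∪
        ⋃ g ∈ q.2, ({x : ι → ℝ | eval x g = 0} ∪ {x | eval x g < 0}))) :=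
    .finset_iInter _ fun q =>
      (IsSemialgebraic.finset_iUnion _ fun f =>
        (isSemialgebraic_pos f).union (isSemialgebraic_neg f)).union
      (.finset_iUnion _ fun g => (isSemialgebraic_eq_zero g).union (isSemialgebraic_neg g))
  convert key using 1
  ext x
  simp only [Set.mem_compl_iff, Set.mem_ofPred_eq, Set.mem_iInter, Set.mem_union, Set.mem_iUnion,
    not_exists, not_and, exists_prop]
  refine forall₂_congr fun q _ => ?_
  rw [← not_and, not_and_or]
  push Not
  refine or_congr ?_ ?_
  · exact exists_congr fun f => and_congr_right fun _ => by rw [ne_iff_lt_or_gt, or_comm]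
  · exact exists_congr fun g => and_congr_right fun _ => by rw [le_iff_eq_or_lt]

theorem isSemialgebraic_sign_eq (p : MvPolynomial ι ℝ) (s : SignType) :
    IsSemialgebraic {x : ι → ℝ | SignType.sign (eval x p) = s} := by
  cases s with
  | zero => simpa [sign_eq_zero_iff] using isSemialgebraic_eq_zero p
  | pos => simpa [sign_eq_one_iff] using isSemialgebraic_pos p
  | neg => simpa [sign_eq_neg_one_iff] using isSemialgebraic_neg p

end Semialgebraic

/-! ### Fourier–Motzkin elimination with polynomial coefficients -/

/-- Solvability of finitely many strict affine inequalities in one real variable. -/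
theorem exists_forall_pos_add_mul_iff {K : Type*} [Finite K] (a b : K → ℝ) :
    (∃ t : ℝ, ∀ k, 0 < b k + a k * t) ↔
      (∀ k, a k = 0 → 0 < b k) ∧
        ∀ k l, 0 < a k → a l < 0 → 0 < a k * b l - a l * b k := by
  classical
  have := Fintype.ofFinite K
  constructor
  · rintro ⟨t, ht⟩
    refine ⟨fun k hk => by simpa [hk] using ht k, fun k l hk hl => ?_⟩
    -- Inequality `l` times `a k` plus inequality `k` times `-a l`: the terms in `t` cancel.
    nlinarith [mul_pos hk (ht l), mul_pos (neg_pos.2 hl) (ht k)]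
  · rintro ⟨h0, h⟩
    -- Positive slopes bound `t` from below by `-b k / a k`, negative slopes from above; finitely
    -- many lower bounds lying below all upper bounds leave room for `t`.
    obtain ⟨t, ht1, ht2⟩ := Order.exists_between_finsets
      (lo := (Finset.univ.filter fun k => 0 < a k).image fun k => -b k / a k)
      (hi := (Finset.univ.filter fun k => a k < 0).image fun k => -b k / a k) (by
        simp only [Finset.forall_mem_image, Finset.mem_filter, Finset.mem_univ, true_and]
        intro k hk l hl
        rw [div_lt_iff₀ hk, div_mul_eq_mul_div, lt_div_iff_of_neg hl]
        linarith [h k l hk hl])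
    simp only [Finset.forall_mem_image, Finset.mem_filter, Finset.mem_univ, true_and] at ht1 ht2
    refine ⟨t, fun k => ?_⟩
    rcases lt_trichotomy (a k) 0 with hk | hk | hk
    · have := ht2 hk
      rw [lt_div_iff_of_neg hk] at this
      linarith
    · simpa [hk] using h0 k hk
    · have := ht1 hk
      rw [div_lt_iff₀ hk] at this
      linarith

/-- The parameters for which a finite system of strict affine inequalities, with coefficients
polynomial in the parameters, is solvable form a semialgebraic set. -/
theorem isSemialgebraic_exists_forall_pos {ι : Type*} (d : ℕ) {K : Type} [Finite K]
    (b : K → MvPolynomial ι ℝ) (a : K → Fin d → MvPolynomial ι ℝ) :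
    IsSemialgebraic {c : ι → ℝ | ∃ x : Fin d → ℝ, ∀ k,
      0 < eval c (b k) + ∑ j, eval c (a k j) * x j} := by
  -- Each elimination enlarges the index type of the system, so `K` must vary.
  induction d generalizing K with
  | zero =>
    convert IsSemialgebraic.iInter fun k => isSemialgebraic_pos (b k) using 1
    ext c
    simp
  | succ d ih =>
    -- For fixed signs `s` of the coefficients of the first variable, the eliminated system is
    -- indexed by `K ⊕ K × K`, with the irrelevant inequalities replaced by `0 < 1`.
    let b' (s : K → SignType) : K ⊕ K × K → MvPolynomial ι ℝ :=
      Sum.elim (fun k => if s k = 0 then b k else 1)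
        fun p => if s p.1 = 1 ∧ s p.2 = -1 then a p.1 0 * b p.2 - a p.2 0 * b p.1 else 1
    let a' (s : K → SignType) : K ⊕ K × K → Fin d → MvPolynomial ι ℝ :=
      Sum.elim (fun k j => if s k = 0 then a k j.succ else 0)
        fun p j => if s p.1 = 1 ∧ s p.2 = -1 then
          a p.1 0 * a p.2 j.succ - a p.2 0 * a p.1 j.succ else 0
    -- Which inequalities get combined depends on the signs of the leading coefficients at `c`; the
    -- finitely many sign vectors are treated case by case.
    have key : IsSemialgebraic (⋃ s : K → SignType,
        ((⋂ k, {c : ι → ℝ | SignType.sign (eval c (a k 0)) = s k}) ∩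
          {c : ι → ℝ | ∃ x : Fin d → ℝ, ∀ k,
            0 < eval c (b' s k) + ∑ j, eval c (a' s k j) * x j})) :=
      .iUnion fun s => (IsSemialgebraic.iInter fun k => isSemialgebraic_sign_eq _ _).inter
        (ih (b' s) (a' s))
    convert key using 1
    ext c
    have step (x : Fin d → ℝ) :
        (∃ t, ∀ k, 0 < eval c (b k) + ∑ j, eval c (a k j) * (Fin.cons t x : Fin (d + 1) → ℝ) j) ↔
          ∀ k, 0 < eval c (b' (fun k => SignType.sign (eval c (a k 0))) k) +
            ∑ j, eval c (a' (fun k => SignType.sign (eval c (a k 0))) k j) * x j := by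
      have := exists_forall_pos_add_mul_iff (fun k => eval c (a k 0))
        (fun k => eval c (b k) + ∑ j : Fin d, eval c (a k j.succ) * x j)
      convert this using 1
      · refine exists_congr fun t => forall_congr' fun k => ?_
        rw [Fin.sum_univ_succ]
        simp only [Fin.cons_zero, Fin.cons_succ]
        rw [add_assoc, add_comm (∑ j : Fin d, _) (_ * t)]
      · rw [Sum.forall, Prod.forall]
        refine and_congr (forall_congr' fun k => ?_)
          (forall_congr' fun k => forall_congr' fun l => ?_)
        · by_cases h : eval c (a k 0) = 0 <;> simp [b', a', h, sign_eq_zero_iff]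
        · by_cases h : 0 < eval c (a k 0) ∧ eval c (a l 0) < 0
          · have e : eval c (a k 0) * (eval c (b l) + ∑ j : Fin d, eval c (a l j.succ) * x j) -
                eval c (a l 0) * (eval c (b k) + ∑ j : Fin d, eval c (a k j.succ) * x j) =
                (eval c (a k 0) * eval c (b l) - eval c (a l 0) * eval c (b k)) +
                ∑ j : Fin d, (eval c (a k 0) * eval c (a l j.succ) -
                  eval c (a l 0) * eval c (a k j.succ)) * x j := by
              simp only [sub_mul, Finset.sum_sub_distrib, mul_assoc, ← Finset.mul_sum]
              ring
            rw [e]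
            simp [b', a', h.1, h.2]
          · have h' : ¬ (SignType.sign (eval c (a k 0)) = 1 ∧
                SignType.sign (eval c (a l 0)) = -1) := by
              simpa only [sign_eq_one_iff, sign_eq_neg_one_iff] using h
            have h'' : 0 < eval c (a k 0) → eval c (a l 0) < 0 →
                0 < eval c (a k 0) * (eval c (b l) + ∑ j : Fin d, eval c (a l j.succ) * x j) -
                eval c (a l 0) * (eval c (b k) + ∑ j : Fin d, eval c (a k j.succ) * x j) :=
              fun h1 h2 => absurd ⟨h1, h2⟩ h
            simp only [b', a', Sum.elim_inr, if_neg h', map_one, map_zero, zero_mul,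
              Finset.sum_const_zero, add_zero, zero_lt_one, true_iff]
            exact h''
    simp only [Set.mem_ofPred_eq, Set.mem_iUnion, Set.mem_inter_iff, Set.mem_iInter]
    constructor
    · rintro ⟨x, hx⟩
      refine ⟨fun k => SignType.sign (eval c (a k 0)), fun k => rfl, Fin.tail x, ?_⟩
      rw [← step]
      exact ⟨x 0, by simpa only [Fin.cons_self_tail] using hx⟩
    · rintro ⟨s, hs, x, hx⟩
      obtain rfl : (fun k => SignType.sign (eval c (a k 0))) = s := funext hs
      obtain ⟨t, ht⟩ := (step x).2 hx
      exact ⟨_, ht⟩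

/-! ### Arrangements and their regions -/

section Arrangement

variable {d n : ℕ}

theorem normal_swap (c : Arrangement d n) (i j : Fin n) : normal c j i = -normal c i j := by
  rcases lt_trichotomy i j with h | rfl | h <;> simp [normal, *, not_lt_of_gt]

theorem normal_ne_zero (c : Arrangement d n) {i j : Fin n} (h : i ≠ j) : normal c i j ≠ 0 := by
  have hc (p : Pairs n) : (c p : EuclideanSpace ℝ (Fin (d + 1))) ≠ 0 :=
    ne_zero_of_mem_unit_sphere _
  rcases h.lt_or_gt with h | h <;> simp [normal, h, not_lt_of_gt, hc]

theorem inner_homogenize (a : EuclideanSpace ℝ (Fin (d + 1))) (x : EuclideanSpace ℝ (Fin d)) :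
    inner ℝ a (homogenize x) = a 0 + ∑ k : Fin d, a k.succ * x k := by
  simp [PiLp.inner_apply, homogenize, Fin.sum_univ_succ, mul_comm]

theorem continuous_inner_homogenize (a : EuclideanSpace ℝ (Fin (d + 1))) :
    Continuous fun x : EuclideanSpace ℝ (Fin d) => inner ℝ a (homogenize x) := by
  simp only [inner_homogenize]
  fun_prop

theorem isOpen_regionMap (c : Arrangement d n) (i : Fin n) : IsOpen (regionMap c i) := by
  simp only [regionMap, Set.ofPred_forall]
  exact isOpen_iInter_of_finite fun j => isOpen_iInter_of_finite fun _ =>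
    isOpen_lt (continuous_inner_homogenize _) continuous_const

theorem convex_regionMap (c : Arrangement d n) (i : Fin n) : Convex ℝ (regionMap c i) := by
  intro x hx y hy s t hs ht hst j hj
  have h : inner ℝ (normal c i j) (homogenize (s • x + t • y)) =
      s * inner ℝ (normal c i j) (homogenize x) + t * inner ℝ (normal c i j) (homogenize y) := by
    simp only [inner_homogenize, PiLp.add_apply, PiLp.smul_apply, smul_eq_mul, mul_add,
      Finset.sum_add_distrib, Finset.mul_sum]
    simp only [mul_left_comm _ s, mul_left_comm _ t]
    -- The constant term is preserved because `s + t = 1`.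
    linear_combination -(normal c i j 0) * hst
  rw [h]
  exact (convex_Iio (0 : ℝ)) (hx j hj) (hy j hj) hs ht hst

theorem disjoint_regionMap (c : Arrangement d n) {i j : Fin n} (h : i ≠ j) :
    Disjoint (regionMap c i) (regionMap c j) := by
  rw [Set.disjoint_left]
  intro x hi hj
  have h1 := hi j h.symm
  have h2 := hj i h
  rw [normal_swap, inner_neg_left] at h2
  linarith

theorem isPartition_regionMap_iff (c : Arrangement d n) :
    IsPartition (regionMap c) ↔ (⋃ i, closure (regionMap c i)) = Set.univ :=
  ⟨fun h => h.cover, fun h =>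
    ⟨isOpen_regionMap c, convex_regionMap c, fun _ _ => disjoint_regionMap c, h⟩⟩

/-- The complement of the affine trace of a central hyperplane is dense. -/
theorem dense_inner_homogenize_ne_zero {a : EuclideanSpace ℝ (Fin (d + 1))} (ha : a ≠ 0) :
    Dense {x : EuclideanSpace ℝ (Fin d) | inner ℝ a (homogenize x) ≠ 0} := by
  intro x
  by_cases hx : inner ℝ a (homogenize x) = 0
  · let v : EuclideanSpace ℝ (Fin d) := WithLp.toLp 2 fun k => a k.succ
    have hline (t : ℝ) : inner ℝ a (homogenize (x + t • v)) =
        t * ∑ k : Fin d, a k.succ * a k.succ := by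
      rw [← zero_add (t * _), ← hx]
      simp only [inner_homogenize, v, PiLp.add_apply, PiLp.smul_apply, smul_eq_mul, mul_add,
        Finset.sum_add_distrib, Finset.mul_sum, mul_left_comm _ t, add_assoc]
    have hs : ∑ k : Fin d, a k.succ * a k.succ ≠ 0 := by
      intro h0
      have h1 : ∀ k : Fin d, a k.succ = 0 := by
        simpa [Finset.sum_eq_zero_iff_of_nonneg, mul_self_nonneg] using h0
      refine ha (PiLp.ext fun k => Fin.cases ?_ h1 k)
      simpa [inner_homogenize, h1] using hx
    have hlim : Filter.Tendsto (fun t : ℝ => x + t • v) (nhdsWithin 0 {0}ᶜ) (nhds x) := by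
      have : Continuous fun t : ℝ => x + t • v := by fun_prop
      simpa using (this.tendsto 0).mono_left nhdsWithin_le_nhds
    refine mem_closure_of_tendsto hlim ?_
    filter_upwards [self_mem_nhdsWithin] with t ht
    rw [hline]
    exact mul_ne_zero ht hs
  · exact subset_closure hx

theorem dense_forall_inner_normal_ne_zero (c : Arrangement d n) :
    Dense {x : EuclideanSpace ℝ (Fin d) |
      ∀ i j, i ≠ j → inner ℝ (normal c i j) (homogenize x) ≠ 0} := by
  have h := dense_iInter_of_isOpen
    (f := fun p : {p : Fin n × Fin n // p.1 ≠ p.2} =>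
      {x : EuclideanSpace ℝ (Fin d) | inner ℝ (normal c p.1.1 p.1.2) (homogenize x) ≠ 0})
    (fun p => isOpen_ne_fun (continuous_inner_homogenize _) continuous_const)
    (fun p => dense_inner_homogenize_ne_zero (normal_ne_zero c p.2))
  convert h using 1
  ext x
  simp

/-- The regions of an arrangement form a partition if and only if there is no point `x` for which
every region `i` has a defining inequality that is strictly violated at `x`. -/
theorem iUnion_closure_regionMap_eq_univ_iff (c : Arrangement d n) :
    (⋃ i, closure (regionMap c i)) = Set.univ ↔
      ∀ f : {f : Fin n → Fin n // ∀ i, f i ≠ i},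
        ¬ ∃ x, ∀ i, 0 < inner ℝ (normal c i (f.1 i)) (homogenize x) := by
  constructor
  · rintro h ⟨f, hf⟩ ⟨x, hx⟩
    obtain ⟨i, hi⟩ := Set.mem_iUnion.1 (h ▸ Set.mem_univ x)
    -- A strict violation at `x` persists nearby, so it would hold at a point of region `i`.
    obtain ⟨y, hy, hyi⟩ := mem_closure_iff.1 hi _
      (isOpen_lt continuous_const (continuous_inner_homogenize (normal c i (f i)))) (hx i)
    exact lt_asymm hy (hyi _ (hf i))
  · intro h
    by_contra hne
    have hopen : IsOpen (⋃ i, closure (regionMap c i))ᶜ :=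
      (isClosed_iUnion_of_finite fun i => isClosed_closure).isOpen_compl
    -- A point of the open uncovered set off all hyperplanes makes every violated inequality
    -- strictly violated.
    obtain ⟨x, hx, hxU⟩ := (dense_forall_inner_normal_ne_zero c).inter_open_nonempty _ hopen
      (Set.nonempty_compl.2 hne)
    have hviol (i : Fin n) : ∃ j, j ≠ i ∧ 0 < inner ℝ (normal c i j) (homogenize x) := by
      by_contra! hi
      exact hx (Set.mem_iUnion.2 ⟨i, subset_closure fun j hj =>
        (hi j hj).lt_of_ne (hxU i j hj.symm)⟩)
    choose f hf hpos using hviol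
    exact h ⟨f, hf⟩ ⟨x, hpos⟩

theorem mem_arrangementsLE_iff (c : Arrangement d n) :
    c ∈ arrangementsLE d n ↔ ∀ f : {f : Fin n → Fin n // ∀ i, f i ≠ i},
      ¬ ∃ x, ∀ i, 0 < inner ℝ (normal c i (f.1 i)) (homogenize x) := by
  rw [← iUnion_closure_regionMap_eq_univ_iff, ← isPartition_regionMap_iff]
  simp [arrangementsLE, partitionsLE, Carries]

theorem mem_arrangements_iff (c : Arrangement d n) :
    c ∈ arrangements d n ↔ c ∈ arrangementsLE d n ∧ ∀ i, (regionMap c i).Nonempty := by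
  simp [arrangementsLE, partitionsLE, arrangements, partitions, Carries]

/-! ### Polynomial description -/

/-- The coordinate `k` of `normal c i j` as a polynomial in the coordinates of `c`. -/
def normalPoly (i j : Fin n) (k : Fin (d + 1)) : MvPolynomial (Pairs n × Fin (d + 1)) ℝ :=
  if h : i < j then X (⟨(i, j), h⟩, k)
  else if h : j < i then -X (⟨(j, i), h⟩, k)
  else 0

theorem eval_normalPoly (c : Arrangement d n) (i j : Fin n) (k : Fin (d + 1)) :
    eval (coords c) (normalPoly i j k) = normal c i j k := by
  unfold normalPoly normal
  split_ifs <;> simp [coords]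

/-- The points of `ℝ^((d+1) × (n choose 2))` for which the vectors with the given indices are
simultaneously positive on some point `(1, x)`. -/
def positivitySet {K : Type} (u v : K → Fin n) : Set (Pairs n × Fin (d + 1) → ℝ) :=
  {y | ∃ x : Fin d → ℝ, ∀ k, 0 < eval y (normalPoly (u k) (v k) 0) +
    ∑ j : Fin d, eval y (normalPoly (u k) (v k) j.succ) * x j}

theorem isSemialgebraic_positivitySet {K : Type} [Finite K] (u v : K → Fin n) :
    IsSemialgebraic (positivitySet (d := d) u v) :=
  isSemialgebraic_exists_forall_pos d _ _

theorem coords_mem_positivitySet {K : Type} (u v : K → Fin n) (c : Arrangement d n) :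
    coords c ∈ positivitySet u v ↔
      ∃ x, ∀ k, 0 < inner ℝ (normal c (u k) (v k)) (homogenize x) := by
  simp only [positivitySet, Set.mem_ofPred_eq, eval_normalPoly, inner_homogenize]
  exact (WithLp.equiv 2 (Fin d → ℝ)).symm.exists_congr fun x => Iff.rfl

theorem regionMap_nonempty_iff (c : Arrangement d n) (i : Fin n) :
    (regionMap c i).Nonempty ↔
      coords c ∈ positivitySet (K := {j : Fin n // j ≠ i}) (fun j => j.1) (fun _ => i) := by
  rw [coords_mem_positivitySet]
  simp only [Set.Nonempty, regionMap, Set.mem_ofPred_eq, normal_swap c i, inner_neg_left,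
    Subtype.forall, Left.neg_pos_iff]

theorem isSemialgebraic_range_coords :
    IsSemialgebraic (Set.range (coords : Arrangement d n → _)) := by
  convert IsSemialgebraic.iInter fun p : Pairs n =>
    isSemialgebraic_eq_zero (∑ k : Fin (d + 1), X (R := ℝ) (p, k) ^ 2 - 1) using 1
  ext y
  simp only [Set.mem_range, Set.mem_iInter, Set.mem_ofPred_eq, map_sub, map_sum, map_pow, eval_X,
    map_one, sub_eq_zero]
  constructor
  · rintro ⟨c, rfl⟩ p
    have h := norm_eq_of_mem_sphere (c p)
    rw [EuclideanSpace.norm_eq, Real.sqrt_eq_one] at h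
    simpa [coords] using h
  · intro h
    refine ⟨fun p => ⟨WithLp.toLp 2 fun k => y (p, k), ?_⟩, rfl⟩
    rw [mem_sphere_zero_iff_norm, EuclideanSpace.norm_eq, Real.sqrt_eq_one]
    simpa using h p

/-- The polynomial conditions need only be correct on the product of spheres, since intersecting
with that semialgebraic set discards all other points. -/
theorem isSemialgebraic_image_coords {S : Set (Arrangement d n)}
    {Y : Set (Pairs n × Fin (d + 1) → ℝ)} (hY : IsSemialgebraic Y)
    (h : ∀ c, c ∈ S ↔ coords c ∈ Y) : IsSemialgebraic (coords '' S) := by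
  obtain rfl : S = coords ⁻¹' Y := Set.ext h
  rw [Set.image_preimage_eq_inter_range]
  exact hY.inter isSemialgebraic_range_coords

/-- The semialgebraic conditions that single out the arrangements carrying a partition. -/
def coverSet (d n : ℕ) : Set (Pairs n × Fin (d + 1) → ℝ) :=
  ⋂ f : {f : Fin n → Fin n // ∀ i, f i ≠ i}, (positivitySet id f.1)ᶜ

theorem isSemialgebraic_coverSet : IsSemialgebraic (coverSet d n) :=
  .iInter fun _ => (isSemialgebraic_positivitySet _ _).compl

theorem mem_arrangementsLE_iff_coords (c : Arrangement d n) :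
    c ∈ arrangementsLE d n ↔ coords c ∈ coverSet d n := by
  simp only [mem_arrangementsLE_iff, coverSet, Set.mem_iInter, Set.mem_compl_iff,
    coords_mem_positivitySet, id]

end Arrangement

end ConvexPartitions

end

theorem theorem4p5 (d n : ℕ) (hd : 0 < d) (hn : 0 < n) :
    ConvexPartitions.IsSemialgebraic
        (ConvexPartitions.coords '' ConvexPartitions.arrangementsLE d n) ∧
      ConvexPartitions.IsSemialgebraic
        (ConvexPartitions.coords '' ConvexPartitions.arrangements d n) := by
  open ConvexPartitions in
  refine ⟨isSemialgebraic_image_coords isSemialgebraic_coverSet mem_arrangementsLE_iff_coords,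
    isSemialgebraic_image_coords (isSemialgebraic_coverSet.inter
      (.iInter fun i => isSemialgebraic_positivitySet (K := {j : Fin n // j ≠ i})
        (fun j => j.1) (fun _ => i))) fun c => ?_⟩
  rw [mem_arrangements_iff, mem_arrangementsLE_iff_coords, Set.mem_inter_iff, Set.mem_iInter]
  simp only [regionMap_nonempty_iff]
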